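/- Let $X$ be a complete separable metric space (a Polish space whose bounded sets are those of a fixed complete metric), and call a Borel measure on $X$ locally finite if it is finite on bounded Borel sets. Let $\mathcal M^{\cdot\cdot}(X)$ be the space of locally finite measures on $X$ that take values in $\{0,1,2,\dots\}$ on bounded Borel sets, with the $\sigma$-algebra generated by the maps $\mu\mapsto\mu(B)$, $B\subseteq X$ Borel. A point process is a probability measure $P$ on $\mathcal M^{\cdot\cdot}(X)$; it is of first order if its first moment measure $\nu_P(B)=\int\mu(B)\,P(d\mu)$ is locally finite. $P$ is a Poisson point process if there is a locally finite measure $\varrho$ on $X$ such that under $P$ the counts $\mu(B_1),\dots,\mu(B_n)$ are independent for all pairwise disjoint bounded Borel sets $B_1,\dots,B_n$, and $\mu(B)$ is Poisson distributed with parameter $\varrho(B)$ for every bounded Borel set $B$. For $q\in(0,1)$ and $\mu\in\mathcal M^{\cdot\cdot}(X)$ let $T^\mu_q$ be the law of the independent $q$-thinning of $\mu$, in which each point of $\mu$ (counted with multiplicity) is kept with probability $q$ and deleted with probability $1-q$, independently of all others; that is, the convolution $T_q^\mu=\ast_{x\in\mu}\big((1-q)\delta_{\mathbf 0}+q\,\delta_{\delta_x}\big)^{\ast\mu(\{x\})}$,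 where $\mathbf 0$ is the zero measure. Put $\Gamma_q(P)=\int P(d\mu)\,T^\mu_q$, and let the splitting law $S_q(P)$ be the probability measure on $\mathcal M^{\cdot\cdot}(X)\times\mathcal M^{\cdot\cdot}(X)$ given by \[ S_q(P)(h)=\int P(d\mu)\int T^\mu_q(d\nu)\,h(\nu,\mu-\nu) \] for non-negative measurable $h$, i.e. the joint law of the retained and the deleted points. **Theorem.** Let $P$ be a point process of first order on $X$. Then $P$ is a Poisson point process if and only if there is some $q\in(0,1)$ such that \[ S_q(P)=\Gamma_q(P)\otimes\Gamma_{1-q}(P). \] -/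

import Mathlib

open MeasureTheory ProbabilityTheory
open scoped ENNReal NNReal unitInterval

namespace PointProcess

section Configurations

variable {X : Type*} [MetricSpace X] [MeasurableSpace X]

/-- A measure is locally finite if it is finite on all bounded Borel sets. -/
def LocallyFinite (μ : Measure X) : Prop :=
  ∀ B : Set X, MeasurableSet B → Bornology.IsBounded B → μ B < ∞

/-- A point measure is a locally finite measure which takes only natural numbers as values on
bounded Borel sets. Multiple points are allowed. -/
def IsPointMeasure (μ : Measure X) : Prop :=
  LocallyFinite μ ∧
    ∀ B : Set X, MeasurableSet B → Bornology.IsBounded B → ∃ n : ℕ, μ B = n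

variable (X) in
/-- The space of locally finite point measures on `X`. As a subtype of `Measure X` it carries the
`σ`-algebra generated by the evaluations `μ ↦ μ B`, `B` Borel. -/
abbrev PointMeasure : Type _ := {μ : Measure X // IsPointMeasure μ}

/-- The multiplicity `μ {x}` of the point `x`, as a natural number. -/
noncomputable def mult (μ : PointMeasure X) (x : X) : ℕ := ⌊(μ.1 {x}).toReal⌋₊

/-- The points of the configuration `μ`, counted with multiplicity: the point `x` occurs as
`⟨x, 0⟩, …, ⟨x, μ {x} - 1⟩`. -/
abbrev Points (μ : PointMeasure X) : Type _ := Σ x : X, Fin (mult μ x)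

/-- The subconfiguration of `μ` that consists of the points marked `true`, as a measure:
the sum of the `δ_x` over the marked points. -/
noncomputable def keptMeasure (μ : PointMeasure X) (ω : Points μ → Bool) : Measure X :=
  Measure.sum fun i : Points μ => if ω i = true then Measure.dirac i.1 else 0

section Helpers

theorem isPointMeasure_sub (μ ν : PointMeasure X) : IsPointMeasure (μ.1 - ν.1) := by
  have hfin : LocallyFinite (μ.1 - ν.1) := fun B hB hb =>
    (Measure.sub_le B).trans_lt (μ.2.1 B hB hb)
  refine ⟨hfin, fun B hB hb => ?_⟩
  have hμ : IsFiniteMeasure (μ.1.restrict B) := ⟨by simpa using μ.2.1 B hB hb⟩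
  have hν : IsFiniteMeasure (ν.1.restrict B) := ⟨by simpa using ν.2.1 B hB hb⟩
  obtain ⟨s, hs, h1, h2⟩ := exists_isHahnDecomposition (μ.1.restrict B) (ν.1.restrict B)
  have e1 : (μ.1.restrict B - ν.1.restrict B) s = 0 :=
    Measure.sub_apply_eq_zero_of_restrict_le_restrict h1 hs
  have e2 : (μ.1.restrict B - ν.1.restrict B) sᶜ = μ.1 (sᶜ ∩ B) - ν.1 (sᶜ ∩ B) := by
    rw [← Measure.restrict_apply_self, Measure.restrict_sub_eq_restrict_sub_restrict hs.compl,
      Measure.sub_apply hs.compl h2]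
    simp [Measure.restrict_apply hs.compl]
  obtain ⟨m, hm⟩ := μ.2.2 _ (hs.compl.inter hB) (hb.subset Set.inter_subset_right)
  obtain ⟨n, hn⟩ := ν.2.2 _ (hs.compl.inter hB) (hb.subset Set.inter_subset_right)
  refine ⟨m - n, ?_⟩
  rw [← Measure.restrict_apply_univ, Measure.restrict_sub_eq_restrict_sub_restrict hB,
    ← Set.union_compl_self s, measure_union disjoint_compl_right hs.compl, e1, e2, hm, hn]
  simp

variable [BorelSpace X]

theorem coe_mult (μ : PointMeasure X) (x : X) : (mult μ x : ℝ≥0∞) = μ.1 {x} := by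
  obtain ⟨n, hn⟩ := μ.2.2 {x} (measurableSet_singleton x) Bornology.isBounded_singleton
  simp [mult, hn]

theorem exists_nat_tsum {ι : Type*} (f : ι → ℕ) (hf : ∑' i, (f i : ℝ≥0∞) ≠ ∞) :
    ∃ n : ℕ, ∑' i, (f i : ℝ≥0∞) = n := by
  have hfin := ENNReal.finite_const_le_of_tsum_ne_top hf one_ne_zero
  refine ⟨∑ i ∈ hfin.toFinset, f i, ?_⟩
  rw [tsum_eq_sum (s := hfin.toFinset), Nat.cast_sum]
  intro i hi
  have : ¬ (1 ≤ f i) := by simpa using hi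
  have : f i = 0 := by omega
  simp [this]

theorem keptMeasure_le (μ : PointMeasure X) (ω : Points μ → Bool) : keptMeasure μ ω ≤ μ.1 := by
  classical
  refine Measure.le_iff.2 fun B hB => ?_
  rw [keptMeasure, Measure.sum_apply _ hB]
  calc ∑' i : Points μ, (if ω i = true then Measure.dirac i.1 else (0 : Measure X)) B
      ≤ ∑' i : Points μ, B.indicator 1 i.1 := by
        refine ENNReal.tsum_le_tsum fun i => ?_
        split_ifs
        · rw [Measure.dirac_apply' _ hB]
        · simp
    _ = ∑' x : X, B.indicator (fun x => μ.1 {x}) x := by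
        rw [ENNReal.tsum_sigma' (β := fun x => Fin (mult μ x))]
        refine tsum_congr fun x => ?_
        by_cases hx : x ∈ B <;> simp [hx, coe_mult]
    _ = ∑' x : B, μ.1 {(x : X)} := (tsum_subtype B fun x => μ.1 {x}).symm
    _ ≤ μ.1 (⋃ x : B, {(x : X)}) :=
        tsum_meas_le_meas_iUnion_of_disjoint _ (fun _ => measurableSet_singleton _)
          fun x y hne => by simpa [Subtype.val_inj] using hne
    _ = μ.1 B := by simp

theorem isPointMeasure_keptMeasure (μ : PointMeasure X) (ω : Points μ → Bool) :
    IsPointMeasure (keptMeasure μ ω) := by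
  classical
  have hfin : LocallyFinite (keptMeasure μ ω) := fun B hB hb =>
    (keptMeasure_le μ ω B).trans_lt (μ.2.1 B hB hb)
  refine ⟨hfin, fun B hB hb => ?_⟩
  have h : keptMeasure μ ω B =
      ∑' i : Points μ, ((if ω i = true ∧ i.1 ∈ B then 1 else 0 : ℕ) : ℝ≥0∞) := by
    rw [keptMeasure, Measure.sum_apply _ hB]
    refine tsum_congr fun i => ?_
    by_cases h1 : ω i = true <;> by_cases h2 : i.1 ∈ B <;>
      simp [h1, h2, Measure.dirac_apply' _ hB]
  rw [h]
  exact exists_nat_tsum _ (h ▸ (hfin B hB hb).ne)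

end Helpers

variable [BorelSpace X]

/-- The subconfiguration of `μ` that consists of the points marked `true`. -/
noncomputable def kept (μ : PointMeasure X) (ω : Points μ → Bool) : PointMeasure X :=
  ⟨keptMeasure μ ω, isPointMeasure_keptMeasure μ ω⟩

/-- The difference `μ - ν` of point measures; for `ν ≤ μ` it is the `η` with `μ = ν + η`. -/
noncomputable instance instSubPointMeasure : Sub (PointMeasure X) :=
  ⟨fun μ ν => ⟨μ.1 - ν.1, isPointMeasure_sub μ ν⟩⟩

end Configurations

section Processes

variable {X : Type*} [MetricSpace X] [MeasurableSpace X] [BorelSpace X]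

/-- The law `T^μ_q` of the independent `q`-thinning of the configuration `μ`: each point of `μ`,
counted with multiplicity, is kept with probability `q` and deleted with probability `1 - q`,
independently of the others. This is the image, under summation over all points of `μ`, of the
product of the laws `(1 - q) δ_0 + q δ_{δ_x}`, that is, the convolution of these laws. -/
noncomputable def thinningLaw (q : I) (μ : PointMeasure X) : Measure (PointMeasure X) :=
  (Measure.infinitePi fun _ : Points μ => bernoulliMeasure true false q).map (kept μ)

/-- The independent `q`-thinning `Γ_q(P) = ∫ P(dμ) T^μ_q` of the point process `P`. -/
noncomputable def thinning (q : I) (P : Measure (PointMeasure X)) : Measure (PointMeasure X) :=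
  P.bind (thinningLaw q)

/-- The splitting law `S_q(P)`: the law of the pair `(ν, μ - ν)` of the retained and the deleted
points, where `μ` has law `P` and `ν` has law `T^μ_q` given `μ`. -/
noncomputable def splittingLaw (q : I) (P : Measure (PointMeasure X)) :
    Measure (PointMeasure X × PointMeasure X) :=
  P.bind fun μ => (thinningLaw q μ).map fun ν => (ν, μ - ν)

/-- The first moment measure `B ↦ ∫ P(dμ) μ(B)`. -/
noncomputable def firstMoment (P : Measure (PointMeasure X)) : Measure X :=
  P.bind Subtype.val

/-- A point process is of first order if its first moment measure is locally finite. -/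
def IsFirstOrder (P : Measure (PointMeasure X)) : Prop := LocallyFinite (firstMoment P)

/-- `P` is the law of a Poisson point process with intensity `ρ`: the numbers of points in
disjoint bounded Borel sets are independent, and the number of points in a bounded Borel set `B`
is Poisson distributed with parameter `ρ B`. -/
structure IsPoissonWithIntensity (ρ : Measure X) (P : Measure (PointMeasure X)) : Prop where
  map_count : ∀ B : Set X, MeasurableSet B → Bornology.IsBounded B →
    P.map (fun μ => μ.1 B) = (poissonMeasure (ρ B).toNNReal).map (fun n : ℕ => (n : ℝ≥0∞))
  indep_count : ∀ (n : ℕ) (B : Fin n → Set X), (∀ i, MeasurableSet (B i)) →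
    (∀ i, Bornology.IsBounded (B i)) → Pairwise (Function.onFun Disjoint B) →
    iIndepFun (fun (i : Fin n) (μ : PointMeasure X) => μ.1 (B i)) P

/-- `P` is a Poisson point process, with some locally finite intensity measure. -/
def IsPoisson (P : Measure (PointMeasure X)) : Prop :=
  ∃ ρ : Measure X, LocallyFinite ρ ∧ IsPoissonWithIntensity ρ P

end Processes

end PointProcess

/-! Everything is read off the generating function G(s) = E ∏ s_i ^ N(A_i) of the counts N(A_i) in a
finite disjoint family of bounded Borel sets, for s in the unit cube. A point of A_i contributes s_i
if kept and t_i if deleted, so the splitting law has generating function G(qs + (1-q)t)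
(`lintegral_splitting`), while the product of the two thinnings has G(qs + 1-q) · G((1-q)t + q).
These functions determine the laws (`ext_of_lintegral_prod_pow_count`), so the splitting identity
amounts to a functional equation for G.

For a Poisson process log G is affine in s, and the equation holds for every q.

Conversely, fix s, put y = 1 - s and ψ(x) = G(1 - xy). The equation becomes ψ(a+b) = ψ(a)ψ(b) for 0
≤ a ≤ q and 0 ≤ b ≤ 1-q, which suffices for ψ(1) = ψ(1/m)^m with m large (`eq_pow_of_local_mul`).
First order gives n(ψ(1/n) - 1) → -∑ ν_P(A_i) y_i (`tendsto_mul_integral_prod_pow_sub_one`), so G(s)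
= ψ(1) is the exponential of this limit (`eq_exp_of_local_mul`): the generating function of
independent Poisson counts with intensity ν_P. -/

namespace PointProcess
open Filter Topology BoundedContinuousFunction unitInterval

/-! ### Probability generating functions on ℕ^ι -/

section GeneratingFunction

variable {ι : Type*} [Fintype ι]

/-- The monomial `k ↦ ∏ i, u i ^ k i` as a bounded function of `k`, for `u` in the unit cube. -/
noncomputable def monomialBCF (u : ι → ℝ≥0) (hu : ∀ i, u i ≤ 1) : (ι → ℕ) →ᵇ ℝ :=
  BoundedContinuousFunction.ofNormedAddCommGroup (fun k => ∏ i, (u i : ℝ) ^ k i)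
    (by fun_prop) 1 fun k => by
      rw [Real.norm_of_nonneg (by positivity)]
      exact Finset.prod_le_one (fun i _ => by positivity) fun i _ => pow_le_one₀ (by positivity)
        (by exact_mod_cast hu i)

theorem monomialBCF_apply (u : ι → ℝ≥0) (hu : ∀ i, u i ≤ 1) (k : ι → ℕ) :
    monomialBCF u hu k = ∏ i, (u i : ℝ) ^ k i := rfl

variable (ι) in
/-- The monomials form a multiplicative submonoid. -/
noncomputable def monomials : Submonoid ((ι → ℕ) →ᵇ ℝ) where
  carrier := {g | ∃ (u : ι → ℝ≥0) (hu : ∀ i, u i ≤ 1), g = monomialBCF u hu}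
  one_mem' := ⟨fun _ => 1, fun _ => le_rfl, by ext k; simp [monomialBCF_apply]⟩
  mul_mem' := by
    rintro _ _ ⟨u, hu, rfl⟩ ⟨v, hv, rfl⟩
    refine ⟨fun i => u i * v i, fun i => mul_le_one' (hu i) (hv i), ?_⟩
    ext k
    simp [monomialBCF_apply, mul_pow, Finset.prod_mul_distrib]

variable (ι) in
/-- The star algebra spanned by the monomials. -/
noncomputable def monomialAlgebra : StarSubalgebra ℝ ((ι → ℕ) →ᵇ ℝ) where
  __ := Algebra.adjoin ℝ (monomials ι : Set ((ι → ℕ) →ᵇ ℝ))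
  star_mem' := by
    intro a ha
    have : star a = a := by ext; simp
    rwa [this]

theorem integral_monomialBCF (u : ι → ℝ≥0) (hu : ∀ i, u i ≤ 1) (μ : Measure (ι → ℕ)) :
    ∫ k, monomialBCF u hu k ∂μ = (∫⁻ k, ∏ i, (u i : ℝ≥0∞) ^ k i ∂μ).toReal := by
  rw [integral_eq_lintegral_of_nonneg_ae]
  · congr 1
    refine lintegral_congr fun k => ?_
    rw [monomialBCF_apply, ENNReal.ofReal_prod_of_nonneg (fun i _ => by positivity)]
    refine Finset.prod_congr rfl fun i _ => ?_
    rw [ENNReal.ofReal_pow (by positivity), ENNReal.ofReal_coe_nnreal]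
  · exact .of_forall fun k => by rw [monomialBCF_apply]; positivity
  · exact (monomialBCF u hu).continuous.aestronglyMeasurable

/-- A distribution on `ℕ^ι` is determined by its probability generating function. -/
theorem ext_of_lintegral_prod_pow {μ ν : Measure (ι → ℕ)} [IsFiniteMeasure μ] [IsFiniteMeasure ν]
    (h : ∀ u : ι → ℝ≥0, (∀ i, u i ≤ 1) →
      ∫⁻ k, ∏ i, (u i : ℝ≥0∞) ^ k i ∂μ = ∫⁻ k, ∏ i, (u i : ℝ≥0∞) ^ k i ∂ν) : μ = ν := by
  classical
  -- It suffices to compare integrals over a star subalgebra that separates points.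
  refine ext_of_forall_mem_subalgebra_integral_eq_of_polish (A := monomialAlgebra ι) ?_ ?_
  · intro k l hkl
    obtain ⟨i, hi⟩ := Function.ne_iff.1 hkl
    -- This monomial sees only the coordinate where k and l differ, through the injective n ↦
    -- (1/2)^n.
    let u : ι → ℝ≥0 := Function.update (fun _ => 1) i (1 / 2)
    have hu : ∀ j, u j ≤ 1 := fun j => by
      by_cases hj : j = i
      · subst hj; simp only [u, Function.update_self]; norm_num
      · simp [u, hj]
    have key : ∀ m : ι → ℕ, monomialBCF u hu m = (1 / 2 : ℝ) ^ m i := fun m => by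
      rw [monomialBCF_apply, Finset.prod_eq_single i]
      · simp [u]
      · intro j _ hj; simp [u, hj]
      · simp
    refine ⟨_, ⟨toContinuousMapStarₐ ℝ (monomialBCF u hu), ⟨monomialBCF u hu, ?_, rfl⟩, rfl⟩, ?_⟩
    · exact Algebra.subset_adjoin ⟨u, hu, rfl⟩
    · change monomialBCF u hu k ≠ monomialBCF u hu l
      rw [key, key]
      intro h'
      exact hi (pow_right_injective₀ (by norm_num) (by norm_num) h')
  · intro g hg
    -- Monomials are closed under products, so the algebra they generate is their linear span and
    -- linearity of the integral finishes.
    have hg' : g ∈ Submodule.span ℝ (monomials ι : Set ((ι → ℕ) →ᵇ ℝ)) := by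
      have : g ∈ Subalgebra.toSubmodule (Algebra.adjoin ℝ (monomials ι : Set ((ι → ℕ) →ᵇ ℝ))) := hg
      rwa [Algebra.adjoin_eq_span, Submonoid.closure_eq] at this
    clear hg
    induction hg' using Submodule.span_induction with
    | mem x hx =>
      obtain ⟨u, hu, rfl⟩ := hx
      rw [integral_monomialBCF, integral_monomialBCF, h u hu]
    | zero => simp
    | add x y _ _ hx hy =>
      simp only [BoundedContinuousFunction.coe_add, Pi.add_apply]
      rw [integral_add (x.integrable μ) (y.integrable μ),
        integral_add (x.integrable ν) (y.integrable ν), hx, hy]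
    | smul a x _ hx =>
      simp only [BoundedContinuousFunction.coe_smul, integral_smul, hx]

theorem lintegral_pow_poissonMeasure (r u : ℝ≥0) :
    ∫⁻ n, (u : ℝ≥0∞) ^ n ∂(poissonMeasure r) = ENNReal.ofReal (Real.exp (-(r * (1 - u)))) := by
  have hs : HasSum (fun n : ℕ => Real.exp (-r) * r ^ n / n.factorial * u ^ n)
      (Real.exp (-(r * (1 - u)))) := by
    convert! (NormedSpace.expSeries_div_hasSum_exp (r * u : ℝ)).mul_left (Real.exp (-r)) using 1
    · ext n; rw [mul_pow]; ring
    · rw [← Real.exp_eq_exp_ℝ, ← Real.exp_add]; ring_nf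
  rw [poissonMeasure, lintegral_sum_measure, ← hs.tsum_eq, ENNReal.ofReal_tsum_of_nonneg
    (fun n => by positivity) hs.summable]
  refine tsum_congr fun n => ?_
  rw [lintegral_smul_measure, lintegral_dirac, smul_eq_mul,
    ENNReal.ofReal_mul (q := (u : ℝ) ^ n) (by positivity),
    ENNReal.ofReal_pow (by positivity), ENNReal.ofReal_coe_nnreal]

end GeneratingFunction

/-! ### Counts of bounded sets and the σ-algebra of configurations -/

section Counts

/-- Recovers the mass of unbounded sets, possibly infinite, from bounded ones. -/
theorem measure_eq_iSup_inter {X : Type*} [MeasurableSpace X] {s : ℕ → Set X} (hs : Monotone s)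
    (hu : ⋃ n, s n = Set.univ)
    (μ : Measure X) (B : Set X) : μ B = ⨆ n, μ (B ∩ s n) := by
  rw [← Monotone.measure_iUnion (fun m n h => Set.inter_subset_inter_right B (hs h)),
    ← Set.inter_iUnion, hu, Set.inter_univ]

variable {X : Type*} [MetricSpace X] [MeasurableSpace X]

/-- The number of points of `μ` in the set `B`; it is meaningful for bounded Borel sets. -/
noncomputable def count (B : Set X) (μ : PointMeasure X) : ℕ := ⌊(μ.1 B).toReal⌋₊

theorem coe_count {B : Set X} (hB : MeasurableSet B) (hb : Bornology.IsBounded B)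
    (μ : PointMeasure X) : (count B μ : ℝ≥0∞) = μ.1 B := by
  obtain ⟨n, hn⟩ := μ.2.2 B hB hb
  simp [count, hn]

theorem measurable_floor_toReal : Measurable fun x : ℝ≥0∞ => ⌊x.toReal⌋₊ :=
  Nat.measurable_floor.comp ENNReal.measurable_toReal

theorem measurable_eval {B : Set X} (hB : MeasurableSet B) :
    Measurable fun μ : PointMeasure X => μ.1 B :=
  (Measure.measurable_coe hB).comp measurable_subtype_coe

theorem measurable_count {B : Set X} (hB : MeasurableSet B) : Measurable (count B) :=
  measurable_floor_toReal.comp (measurable_eval hB)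

theorem exists_monotone_bounded_cover [BorelSpace X] : ∃ s : ℕ → Set X, Monotone s ∧
    (∀ n, MeasurableSet (s n)) ∧ (∀ n, Bornology.IsBounded (s n)) ∧ ⋃ n, s n = Set.univ := by
  rcases isEmpty_or_nonempty X with h | ⟨⟨x⟩⟩
  · exact ⟨fun _ => ∅, fun _ _ _ => le_rfl, by simp, by simp, Set.eq_univ_of_forall fun x => h.elim x⟩
  · exact ⟨fun n => Metric.ball x n, fun m n h => Metric.ball_subset_ball (by exact_mod_cast h),
      fun n => measurableSet_ball, fun n => Metric.isBounded_ball, Metric.iUnion_ball_nat x⟩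

theorem sigmaFinite_coe [BorelSpace X] (μ : PointMeasure X) : SigmaFinite μ.1 := by
  obtain ⟨s, -, hm, hb, hu⟩ := exists_monotone_bounded_cover (X := X)
  exact ⟨⟨⟨s, fun _ => trivial, fun n => μ.2.1 _ (hm n) (hb n), hu⟩⟩⟩

/-- The `σ`-algebra on point measures is generated by the counts of bounded Borel sets. -/
theorem measurableSpace_eq_iSup [BorelSpace X] :
    (inferInstance : MeasurableSpace (PointMeasure X)) =
      ⨆ B : {B : Set X // MeasurableSet B ∧ Bornology.IsBounded B},
        MeasurableSpace.comap (count B.1) ⊤ := by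
  apply le_antisymm
  · obtain ⟨s, hs, hm, hb, hu⟩ := exists_monotone_bounded_cover (X := X)
    have key : Measurable[⨆ B : {B : Set X // MeasurableSet B ∧ Bornology.IsBounded B},
        MeasurableSpace.comap (count B.1) ⊤] (Subtype.val : PointMeasure X → Measure X) := by
      refine @Measure.measurable_of_measurable_coe _ _ _ (_) _ fun B hB => ?_
      simp_rw [fun μ : PointMeasure X => measure_eq_iSup_inter hs hu μ.1 B]
      refine @Measurable.iSup _ _ _ _ _ (_) _ _ inferInstance _ _ _ fun n => ?_
      have hBn := hB.inter (hm n)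
      have hBb := (hb n).subset (Set.inter_subset_right (s := B))
      simp_rw [← coe_count hBn hBb]
      refine (measurable_from_top (f := fun n : ℕ => (n : ℝ≥0∞))).comp ?_
      exact (comap_measurable (m := ⊤) (count (B ∩ s n))).mono
        (le_iSup (fun B : {B : Set X // MeasurableSet B ∧ Bornology.IsBounded B} =>
          MeasurableSpace.comap (count B.1) ⊤) ⟨_, hBn, hBb⟩) le_rfl
    exact key.comap_le
  · exact iSup_le fun B => (measurable_count B.2.1).comap_le

theorem measurable_of_count [BorelSpace X] {Ω : Type*} [MeasurableSpace Ω] {f : Ω → PointMeasure X}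
    (h : ∀ B, MeasurableSet B → Bornology.IsBounded B → Measurable fun ω => count B (f ω)) :
    Measurable f := by
  have := measurableSpace_eq_iSup (X := X)
  intro s hs
  suffices H : MeasurableSpace.comap f inferInstance ≤ (inferInstance : MeasurableSpace Ω) from
    H _ ⟨s, hs, rfl⟩
  rw [this, MeasurableSpace.comap_iSup]
  refine iSup_le fun B => ?_
  rw [MeasurableSpace.comap_comp]
  exact (h B.1 B.2.1 B.2.2).comap_le

theorem count_iUnion {ι : Type*} [Fintype ι] {A : ι → Set X} (hm : ∀ i, MeasurableSet (A i))
    (hb : ∀ i, Bornology.IsBounded (A i)) (hd : Pairwise (Function.onFun Disjoint A))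
    (s : Finset ι) (μ : PointMeasure X) :
    count (⋃ i ∈ s, A i) μ = ∑ i ∈ s, count (A i) μ := by
  have h1 : MeasurableSet (⋃ i ∈ s, A i) := s.measurableSet_biUnion fun i _ => hm i
  have h2 : Bornology.IsBounded (⋃ i ∈ s, A i) :=
    (Bornology.isBounded_biUnion_finset s).2 fun i _ => hb i
  have : ((count (⋃ i ∈ s, A i) μ : ℕ) : ℝ≥0∞) = (∑ i ∈ s, count (A i) μ : ℕ) := by
    rw [coe_count h1 h2, measure_biUnion_finset (fun i _ j _ h => hd h) fun i _ => hm i]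
    push_cast
    exact Finset.sum_congr rfl fun i _ => (coe_count (hm i) (hb i) μ).symm
  exact_mod_cast this

/-- Counts of overlapping sets become sums of counts of disjoint cells, to which generating
functions apply. -/
theorem exists_disjoint_refinement {F : Type*} [Fintype F] [DecidableEq F] {B : F → Set X}
    (hm : ∀ j, MeasurableSet (B j)) (hb : ∀ j, Bornology.IsBounded (B j)) :
    ∃ A : (F → Bool) → Set X, (∀ ε, MeasurableSet (A ε)) ∧ (∀ ε, Bornology.IsBounded (A ε)) ∧
      Pairwise (Function.onFun Disjoint A) ∧
      ∀ j, B j = ⋃ ε ∈ (Finset.univ.filter fun ε : F → Bool => ε j = true), A ε := by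
  classical
  -- The cell of ε consists of the points whose membership pattern is ε. Intersecting with the union
  -- keeps the all-false cell bounded (it becomes empty).
  refine ⟨fun ε => {x | (fun j => decide (x ∈ B j)) = ε} ∩ ⋃ j, B j, fun ε => ?_, fun ε => ?_, ?_,
    fun j => ?_⟩
  · refine MeasurableSet.inter ?_ (.iUnion hm)
    have : {x | (fun j => decide (x ∈ B j)) = ε} = ⋂ j, {x | x ∈ B j ↔ ε j = true} := by
      ext x
      simp only [funext_iff, Set.mem_ofPred_eq, Set.mem_iInter]
      exact forall_congr' fun j => by cases ε j <;> simp
    rw [this]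
    refine .iInter fun j => ?_
    cases ε j
    · convert! (hm j).compl using 1; ext x; simp
    · simpa using hm j
  · exact ((Bornology.isBounded_iUnion).2 hb).subset Set.inter_subset_right
  · intro ε ε' h
    refine Set.disjoint_left.2 fun x hx hx' => h (hx.1.symm.trans hx'.1)
  · ext x
    simp only [Finset.mem_filter, Finset.mem_univ, true_and, Set.mem_iUnion, Set.mem_inter_iff,
      Set.mem_ofPred_eq, exists_prop]
    constructor
    · exact fun hx => ⟨_, by simpa using hx, rfl, j, hx⟩
    · rintro ⟨ε, h1, rfl, -⟩
      simpa using h1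

/-- The numbers of points of the two components of a pair in the sets of a family. -/
noncomputable def jointCount {ι : Type*} (A : ι → Set X) (p : PointMeasure X × PointMeasure X) :
    ι ⊕ ι → ℕ :=
  Sum.elim (fun i => count (A i) p.1) fun i => count (A i) p.2

theorem measurable_jointCount {ι : Type*} {A : ι → Set X} (hm : ∀ i, MeasurableSet (A i)) :
    Measurable (jointCount A) := by
  refine measurable_pi_iff.2 fun i => ?_
  cases i with
  | inl i => exact (measurable_count (hm i)).comp measurable_fst
  | inr i => exact (measurable_count (hm i)).comp measurable_snd

end Counts

/-! ### Cylinder events determine joint laws and measurability of kernels -/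

section Cylinders

universe u
variable {X : Type u} [MetricSpace X] [MeasurableSpace X]

variable (X) in
/-- The events that are expressed by the counts of both components in finitely many bounded
Borel sets. -/
def countCylinders : Set (Set (PointMeasure X × PointMeasure X)) :=
  piiUnionInter (fun B : {B : Set X // MeasurableSet B ∧ Bornology.IsBounded B} =>
    {s | MeasurableSet[MeasurableSpace.comap
      (fun p : PointMeasure X × PointMeasure X => (count B.1 p.1, count B.1 p.2)) ⊤] s}) Set.univ

theorem isPiSystem_countCylinders : IsPiSystem (countCylinders X) :=
  isPiSystem_piiUnionInter _ (fun _ => @MeasurableSpace.isPiSystem_measurableSet _ (_)) _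

theorem generateFrom_countCylinders [BorelSpace X] :
    (inferInstance : MeasurableSpace (PointMeasure X × PointMeasure X)) =
      MeasurableSpace.generateFrom (countCylinders X) := by
  rw [countCylinders, generateFrom_piiUnionInter_measurableSet
    (fun B : {B : Set X // MeasurableSet B ∧ Bornology.IsBounded B} => MeasurableSpace.comap
      (fun p : PointMeasure X × PointMeasure X => (count B.1 p.1, count B.1 p.2)) ⊤)]
  apply le_antisymm
  · change MeasurableSpace.comap _ _ ⊔ MeasurableSpace.comap _ _ ≤ _
    have := measurableSpace_eq_iSup (X := X)
    refine sup_le ?_ ?_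
    · change MeasurableSpace.comap Prod.fst inferInstance ≤ _
      rw [this, MeasurableSpace.comap_iSup]
      refine iSup_le fun B => le_trans ?_ (le_iSup₂ B (Set.mem_univ _))
      rw [MeasurableSpace.comap_comp]
      rintro _ ⟨s, -, rfl⟩
      exact ⟨Prod.fst ⁻¹' s, trivial, rfl⟩
    · change MeasurableSpace.comap Prod.snd inferInstance ≤ _
      rw [this, MeasurableSpace.comap_iSup]
      refine iSup_le fun B => le_trans ?_ (le_iSup₂ B (Set.mem_univ _))
      rw [MeasurableSpace.comap_comp]
      rintro _ ⟨s, -, rfl⟩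
      exact ⟨Prod.snd ⁻¹' s, trivial, rfl⟩
  · refine iSup₂_le fun B _ => ?_
    have h : Measurable fun p : PointMeasure X × PointMeasure X => (count B.1 p.1, count B.1 p.2) :=
      ((measurable_count B.2.1).comp measurable_fst).prodMk
        ((measurable_count B.2.1).comp measurable_snd)
    rintro _ ⟨s, -, rfl⟩
    exact h (Set.to_countable s).measurableSet

/-- A cylinder event is an event about the counts of a disjoint family. -/
theorem exists_jointCount_of_mem_countCylinders {E : Set (PointMeasure X × PointMeasure X)}
    (hE : E ∈ countCylinders X) :
    ∃ (ι : Type u) (_ : Fintype ι) (A : ι → Set X) (D : Set (ι ⊕ ι → ℕ)),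
      (∀ i, MeasurableSet (A i)) ∧ (∀ i, Bornology.IsBounded (A i)) ∧
      Pairwise (Function.onFun Disjoint A) ∧ E = jointCount A ⁻¹' D := by
  classical
  obtain ⟨t, -, f, hf, rfl⟩ := hE
  choose! g _ hg using hf
  obtain ⟨A, hm, hb, hd, hA⟩ := exists_disjoint_refinement (F := t) (B := fun j => j.1.1)
    (fun j => j.1.2.1) fun j => j.1.2.2
  -- The cells are indexed by membership patterns, a type in the universe of X; each original count
  -- is the sum over the cells with ε j = true.
  refine ⟨t → Bool, inferInstance, A, {k | ∀ j : t,
    (∑ ε : t → Bool with ε j = true, k (.inl ε), ∑ ε : t → Bool with ε j = true, k (.inr ε)) ∈ g j},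
    hm, hb, hd, ?_⟩
  ext p
  have key : ∀ j : t, p ∈ f j ↔ (∑ ε : t → Bool with ε j = true, count (A ε) p.1,
      ∑ ε : t → Bool with ε j = true, count (A ε) p.2) ∈ g j := fun j => by
    rw [← count_iUnion hm hb hd, ← count_iUnion hm hb hd, ← hA j, ← hg j j.2]
    rfl
  simp only [Set.mem_iInter]
  exact ⟨fun h j => (key j).1 (h j j.2), fun h j hj => (key ⟨j, hj⟩).2 (h ⟨j, hj⟩)⟩

theorem prod_jointCount {ι : Type*} [Fintype ι] (A : ι → Set X) (w : ι ⊕ ι → ℝ≥0)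
    (p : PointMeasure X × PointMeasure X) : ∏ i, (w i : ℝ≥0∞) ^ jointCount A p i =
      (∏ i, (w (.inl i) : ℝ≥0∞) ^ count (A i) p.1) *
        ∏ i, (w (.inr i) : ℝ≥0∞) ^ count (A i) p.2 := by
  simp [Fintype.prod_sum_type, jointCount]

/-- The joint law of two point processes is determined by the joint generating functions of the
counts of disjoint families. -/
theorem ext_of_lintegral_prod_pow_count [BorelSpace X]
    {P Q : Measure (PointMeasure X × PointMeasure X)}
    [IsProbabilityMeasure P] [IsProbabilityMeasure Q]
    (h : ∀ (ι : Type u) [Fintype ι] (A : ι → Set X), (∀ i, MeasurableSet (A i)) →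
      (∀ i, Bornology.IsBounded (A i)) → Pairwise (Function.onFun Disjoint A) →
      ∀ s t : ι → ℝ≥0, (∀ i, s i ≤ 1) → (∀ i, t i ≤ 1) →
      ∫⁻ p, (∏ i, (s i : ℝ≥0∞) ^ count (A i) p.1) * ∏ i, (t i : ℝ≥0∞) ^ count (A i) p.2 ∂P =
      ∫⁻ p, (∏ i, (s i : ℝ≥0∞) ^ count (A i) p.1) * ∏ i, (t i : ℝ≥0∞) ^ count (A i) p.2 ∂Q) :
    P = Q := by
  refine ext_of_generate_finite _ generateFrom_countCylinders isPiSystem_countCylinders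
    (fun E hE => ?_) (by simp)
  obtain ⟨ι, _, A, D, hm, hb, hd, rfl⟩ := exists_jointCount_of_mem_countCylinders hE
  have hJ := measurable_jointCount hm
  have : P.map (jointCount A) = Q.map (jointCount A) := by
    have := Measure.isProbabilityMeasure_map (μ := P) hJ.aemeasurable
    have := Measure.isProbabilityMeasure_map (μ := Q) hJ.aemeasurable
    refine ext_of_lintegral_prod_pow fun w hw => ?_
    rw [lintegral_map (by fun_prop) hJ, lintegral_map (by fun_prop) hJ]
    simp_rw [prod_jointCount]
    exact h ι A hm hb hd _ _ (fun i => hw _) fun i => hw _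
  have hD : MeasurableSet D := D.to_countable.measurableSet
  rw [← Measure.map_apply hJ hD, this, Measure.map_apply hJ hD]

/-- A kernel into pairs of configurations is measurable if the generating functions of the counts
of each disjoint family depend only on the counts of the argument. -/
theorem measurable_of_lintegral_prod_pow_count [BorelSpace X]
    {κ : PointMeasure X → Measure (PointMeasure X × PointMeasure X)}
    [∀ μ, IsProbabilityMeasure (κ μ)]
    (h : ∀ (ι : Type u) [Fintype ι] (A : ι → Set X), (∀ i, MeasurableSet (A i)) →
      (∀ i, Bornology.IsBounded (A i)) → Pairwise (Function.onFun Disjoint A) →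
      ∀ s t : ι → ℝ≥0, (∀ i, s i ≤ 1) → (∀ i, t i ≤ 1) →
      ∀ μ ν, (∀ i, count (A i) μ = count (A i) ν) →
      ∫⁻ p, (∏ i, (s i : ℝ≥0∞) ^ count (A i) p.1) * ∏ i, (t i : ℝ≥0∞) ^ count (A i) p.2 ∂(κ μ) =
      ∫⁻ p, (∏ i, (s i : ℝ≥0∞) ^ count (A i) p.1) * ∏ i, (t i : ℝ≥0∞) ^ count (A i) p.2 ∂(κ ν)) :
    Measurable κ := by
  refine Measurable.measure_of_isPiSystem_of_isProbabilityMeasure generateFrom_countCylinders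
    isPiSystem_countCylinders fun E hE => ?_
  obtain ⟨ι, _, A, D, hm, hb, hd, rfl⟩ := exists_jointCount_of_mem_countCylinders hE
  have hJ := measurable_jointCount hm
  have hD : MeasurableSet D := D.to_countable.measurableSet
  have key : Function.FactorsThrough (fun μ => κ μ (jointCount A ⁻¹' D))
      fun μ i => count (A i) μ := by
    intro μ ν hμν
    have : (κ μ).map (jointCount A) = (κ ν).map (jointCount A) := by
      have := Measure.isProbabilityMeasure_map (μ := κ μ) hJ.aemeasurable
      have := Measure.isProbabilityMeasure_map (μ := κ ν) hJ.aemeasurable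
      refine ext_of_lintegral_prod_pow fun w hw => ?_
      rw [lintegral_map (by fun_prop) hJ, lintegral_map (by fun_prop) hJ]
      simp_rw [prod_jointCount]
      exact h ι A hm hb hd _ _ (fun i => hw _) (fun i => hw _) μ ν (congrFun hμν)
    change κ μ _ = κ ν _
    rw [← Measure.map_apply hJ hD, this, Measure.map_apply hJ hD]
  -- The event's probability is a function of a count vector in the countable space ℕ^ι, where every
  -- function is measurable; the value 0 outside the range of the counts is immaterial.
  have hext := key.extend_comp fun _ => 0
  rw [← hext]
  exact (measurable_of_countable _).comp (measurable_pi_lambda _ fun i => measurable_count (hm i))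

end Cylinders

/-! ### Point measures as sums over their points -/

section Atoms

theorem count_sub {X : Type*} [MetricSpace X] [MeasurableSpace X] {B : Set X}
    (hB : MeasurableSet B) (hb : Bornology.IsBounded B) {μ ν : PointMeasure X} (h : ν.1 ≤ μ.1) : count B (μ - ν) = count B μ - count B ν := by
  have : (count B (μ - ν) : ℝ≥0∞) = (count B μ - count B ν : ℕ) := by
    push_cast
    rw [coe_count hB hb, coe_count hB hb, coe_count hB hb]
    -- The formula for a difference of measures needs the subtracted one to be finite, hence the
    -- restriction to B.
    have hν : IsFiniteMeasure (ν.1.restrict B) := ⟨by simpa using ν.2.1 B hB hb⟩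
    change (μ.1 - ν.1) B = _
    rw [← Measure.restrict_apply_univ, Measure.restrict_sub_eq_restrict_sub_restrict hB,
      Measure.sub_apply .univ (Measure.restrict_mono le_rfl h)]
    simp
  exact_mod_cast this

variable {X : Type*} [MetricSpace X] [TopologicalSpace.SeparableSpace X] [MeasurableSpace X]
  [BorelSpace X]

theorem countable_atoms (μ : PointMeasure X) : {x | μ.1 {x} ≠ 0}.Countable := by
  have := sigmaFinite_coe μ
  have := Measure.countable_meas_pos_of_disjoint_iUnion (μ := μ.1) (As := fun x : X => {x})
    (fun x => measurableSet_singleton x) fun x y h => by simpa using h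
  simpa [pos_iff_ne_zero] using this

/-- A point measure on a separable metric space is purely atomic. -/
theorem measure_compl_atoms (μ : PointMeasure X) : μ.1 {x | μ.1 {x} = 0} = 0 := by
  have := UniformSpace.secondCountable_of_separable X
  -- By second countability a local argument is enough. Outer regularity of the finite restriction
  -- to a ball gives a non-atom a neighbourhood of mass below 1, and an integer mass below 1 is 0.
  refine measure_null_of_locally_null _ fun x hx => ?_
  have hfin : IsFiniteMeasure (μ.1.restrict (Metric.ball x 1)) :=
    ⟨by simpa using μ.2.1 _ measurableSet_ball Metric.isBounded_ball⟩
  have h0 : μ.1.restrict (Metric.ball x 1) {x} < 1 := by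
    refine (Measure.restrict_apply_le _ _).trans_lt ?_
    rw [show μ.1 {x} = 0 from hx]
    exact one_pos
  obtain ⟨U, hxU, hU, hlt⟩ := Set.exists_isOpen_lt_of_lt {x} 1 h0
  rw [Measure.restrict_apply hU.measurableSet] at hlt
  refine ⟨U ∩ Metric.ball x 1, mem_nhdsWithin_of_mem_nhds (inter_mem (hU.mem_nhds (hxU rfl))
    (Metric.ball_mem_nhds x one_pos)), ?_⟩
  obtain ⟨n, hn⟩ := μ.2.2 _ (hU.measurableSet.inter measurableSet_ball)
    (Metric.isBounded_ball.subset Set.inter_subset_right)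
  rw [hn] at hlt ⊢
  have : n < 1 := by exact_mod_cast hlt
  simp [Nat.lt_one_iff.1 this]

theorem measure_eq_tsum_atoms (μ : PointMeasure X) (B : Set X) :
    μ.1 B = ∑' x : X, B.indicator (fun x => μ.1 {x}) x := by
  have hc : (B ∩ {x | μ.1 {x} ≠ 0}).Countable := (countable_atoms μ).mono Set.inter_subset_right
  have h1 : μ.1 B = μ.1 (B ∩ {x | μ.1 {x} ≠ 0}) := by
    refine le_antisymm ?_ (measure_mono Set.inter_subset_left)
    calc μ.1 B ≤ μ.1 ((B ∩ {x | μ.1 {x} ≠ 0}) ∪ {x | μ.1 {x} = 0}) :=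
          measure_mono fun x hx => by by_cases h : μ.1 {x} = 0 <;> simp [h, hx]
      _ ≤ _ := (measure_union_le _ _).trans (by rw [measure_compl_atoms, add_zero])
  have := hc.to_subtype
  rw [h1, ← Set.biUnion_of_singleton (B ∩ {x | μ.1 {x} ≠ 0}),
    measure_biUnion hc (fun x _ y _ h => by simpa using h) fun x _ => measurableSet_singleton x,
    tsum_subtype (B ∩ {x | μ.1 {x} ≠ 0}) fun x => μ.1 {x}]
  refine tsum_congr fun x => ?_
  by_cases h : μ.1 {x} = 0 <;> by_cases hx : x ∈ B <;> simp [h, hx]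

theorem measure_eq_tsum_points (μ : PointMeasure X) (B : Set X) :
    μ.1 B = ∑' i : Points μ, B.indicator 1 i.1 := by
  rw [measure_eq_tsum_atoms, ENNReal.tsum_sigma' (β := fun x => Fin (mult μ x))]
  refine tsum_congr fun x => ?_
  by_cases hx : x ∈ B <;> simp [hx, coe_mult]

theorem finite_points {B : Set X} (hB : MeasurableSet B) (hb : Bornology.IsBounded B)
    (μ : PointMeasure X) : {i : Points μ | i.1 ∈ B}.Finite := by
  have h : ∑' i : Points μ, B.indicator (1 : X → ℝ≥0∞) i.1 ≠ ∞ := by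
    rw [← measure_eq_tsum_points]; exact (μ.2.1 B hB hb).ne
  refine (ENNReal.finite_const_le_of_tsum_ne_top h one_ne_zero).subset fun i hi => ?_
  simp [Set.indicator_of_mem (show i.1 ∈ B from hi)]

theorem count_kept {B : Set X} (hB : MeasurableSet B) (hb : Bornology.IsBounded B)
    (μ : PointMeasure X) (ω : Points μ → Bool) :
    count B (kept μ ω) = ∑ i ∈ (finite_points hB hb μ).toFinset, if ω i = true then 1 else 0 := by
  have : (count B (kept μ ω) : ℝ≥0∞) =
      (∑ i ∈ (finite_points hB hb μ).toFinset, if ω i = true then 1 else 0 : ℕ) := by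
    rw [coe_count hB hb]
    change keptMeasure μ ω B = _
    rw [keptMeasure, Measure.sum_apply _ hB, tsum_eq_sum (s := (finite_points hB hb μ).toFinset)]
    · push_cast
      refine Finset.sum_congr rfl fun i hi => ?_
      have hi' : i.1 ∈ B := by simpa using hi
      by_cases h : ω i = true <;> simp [h, Measure.dirac_apply' _ hB, hi']
    · intro i hi
      have hi' : i.1 ∉ B := by simpa using hi
      by_cases h : ω i = true <;> simp [h, Measure.dirac_apply' _ hB, hi']
  exact_mod_cast this

theorem count_eq_card_points {B : Set X} (hB : MeasurableSet B) (hb : Bornology.IsBounded B)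
    (μ : PointMeasure X) : count B μ = (finite_points hB hb μ).toFinset.card := by
  have : (count B μ : ℝ≥0∞) = (finite_points hB hb μ).toFinset.card := by
    rw [coe_count hB hb, measure_eq_tsum_points, tsum_eq_sum (s := (finite_points hB hb μ).toFinset)]
    · rw [Finset.card_eq_sum_ones]
      push_cast
      refine Finset.sum_congr rfl fun i hi => ?_
      have hi' : i.1 ∈ B := by simpa using hi
      simp [hi']
    · intro i hi
      have hi' : i.1 ∉ B := by simpa using hi
      simp [hi']
  exact_mod_cast this

theorem measurable_kept (μ : PointMeasure X) : Measurable (kept μ) := by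
  refine measurable_of_count fun B hB hb => ?_
  simp_rw [count_kept hB hb]
  refine Finset.measurable_sum _ fun i _ => ?_
  exact (measurable_of_countable fun b : Bool => if b = true then 1 else 0).comp
    (measurable_pi_apply i)

theorem count_sub_kept {B : Set X} (hB : MeasurableSet B) (hb : Bornology.IsBounded B)
    (μ : PointMeasure X) (ω : Points μ → Bool) :
    count B (μ - kept μ ω) =
      ∑ i ∈ (finite_points hB hb μ).toFinset, if ω i = true then 0 else 1 := by
  rw [count_sub hB hb (keptMeasure_le μ ω), count_kept hB hb, count_eq_card_points hB hb,
    Finset.card_eq_sum_ones]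
  refine Nat.sub_eq_of_eq_add ?_
  rw [← Finset.sum_add_distrib]
  exact Finset.sum_congr rfl fun i _ => by split_ifs <;> rfl

/-- Both measures are purely atomic, so the order reduces to countably many conditions on
evaluations; this makes {ν ≤ μ} measurable. -/
theorem le_iff_atoms (μ ν : PointMeasure X) :
    ν.1 ≤ μ.1 ↔ ν.1 {x | μ.1 {x} = 0} = 0 ∧ ∀ x ∈ {x | μ.1 {x} ≠ 0}, ν.1 {x} ≤ μ.1 {x} := by
  refine ⟨fun h => ⟨le_antisymm ((h _).trans (measure_compl_atoms μ).le) bot_le, fun x _ => h _⟩,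
    fun ⟨h0, h⟩ => Measure.le_iff.2 fun B _ => ?_⟩
  rw [measure_eq_tsum_atoms, measure_eq_tsum_atoms]
  refine ENNReal.tsum_le_tsum fun x => Set.indicator_le_indicator ?_
  by_cases hx : μ.1 {x} = 0
  · exact (measure_mono_null (s := {x}) (t := {x | μ.1 {x} = 0})
      (Set.singleton_subset_iff.2 hx) h0).le.trans bot_le
  · exact h x hx

theorem measurableSet_le (μ : PointMeasure X) : MeasurableSet {ν : PointMeasure X | ν.1 ≤ μ.1} := by
  simp_rw [le_iff_atoms]
  have hm : MeasurableSet {x | μ.1 {x} = 0} := by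
    have := (countable_atoms μ).measurableSet.compl
    convert this using 1
    ext x; simp
  refine MeasurableSet.inter (measurable_eval hm (measurableSet_singleton 0)) ?_
  have : {ν : PointMeasure X | ∀ x ∈ {x | μ.1 {x} ≠ 0}, ν.1 {x} ≤ μ.1 {x}} =
      ⋂ x ∈ {x | μ.1 {x} ≠ 0}, {ν | ν.1 {x} ≤ μ.1 {x}} := by ext; simp
  change MeasurableSet {ν : PointMeasure X | ∀ x ∈ {x | μ.1 {x} ≠ 0}, ν.1 {x} ≤ μ.1 {x}}
  rw [this]
  exact .biInter (countable_atoms μ) fun x _ =>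
    measurable_eval (measurableSet_singleton x) measurableSet_Iic

end Atoms

/-! ### Thinning and splitting a fixed configuration -/

section Thinning

variable {X : Type*} [MetricSpace X] [TopologicalSpace.SeparableSpace X] [MeasurableSpace X]
  [BorelSpace X]

theorem measurable_sub_kept (μ : PointMeasure X) : Measurable fun ω => μ - kept μ ω := by
  refine measurable_of_count fun B hB hb => ?_
  simp_rw [count_sub_kept hB hb]
  refine Finset.measurable_sum _ fun i _ => ?_
  exact (measurable_of_countable fun b : Bool => if b = true then 0 else 1).comp
    (measurable_pi_apply i)

instance (q : I) (μ : PointMeasure X) : IsProbabilityMeasure (thinningLaw q μ) :=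
  Measure.isProbabilityMeasure_map (measurable_kept μ).aemeasurable

/-- Counts of μ - ν are differences of counts when ν ≤ μ, and the thinning law is concentrated
there. Without a.e. measurability the `Measure.map` in `splittingLaw` would be 0. -/
theorem aemeasurable_sub (q : I) (μ : PointMeasure X) :
    AEMeasurable (fun ν => μ - ν) (thinningLaw q μ) := by
  classical
  -- The value μ on the null set where ν ≤ μ fails is arbitrary.
  refine ⟨fun ν => if ν.1 ≤ μ.1 then μ - ν else μ, ?_, ?_⟩
  · refine measurable_of_count fun B hB hb => ?_
    have : (fun ν : PointMeasure X => count B (if ν.1 ≤ μ.1 then μ - ν else μ)) =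
        fun ν => if ν.1 ≤ μ.1 then count B μ - count B ν else count B μ := by
      ext ν
      split_ifs with h
      · exact count_sub hB hb h
      · rfl
    rw [this]
    exact Measurable.ite (measurableSet_le μ) (measurable_const.sub (measurable_count hB))
      measurable_const
  · have hle : ∀ᵐ ν ∂(thinningLaw q μ), ν.1 ≤ μ.1 :=
      (ae_map_iff (measurable_kept μ).aemeasurable (measurableSet_le μ)).2
        (.of_forall fun ω => keptMeasure_le μ ω)
    filter_upwards [hle] with ν hν
    exact (if_pos hν).symm

/-- The joint law of the retained and the deleted points of a configuration. -/
noncomputable def splitting (q : I) (μ : PointMeasure X) :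
    Measure (PointMeasure X × PointMeasure X) :=
  (Measure.infinitePi fun _ : Points μ => bernoulliMeasure true false q).map
    fun ω => (kept μ ω, μ - kept μ ω)

theorem measurable_kept_sub_kept (μ : PointMeasure X) :
    Measurable fun ω => (kept μ ω, μ - kept μ ω) :=
  (measurable_kept μ).prodMk (measurable_sub_kept μ)

instance (q : I) (μ : PointMeasure X) : IsProbabilityMeasure (splitting q μ) :=
  Measure.isProbabilityMeasure_map (measurable_kept_sub_kept μ).aemeasurable

theorem map_thinningLaw_eq_splitting (q : I) (μ : PointMeasure X) :
    ((thinningLaw q μ).map fun ν => (ν, μ - ν)) = splitting q μ :=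
  AEMeasurable.map_map_of_aemeasurable (aemeasurable_id.prodMk (aemeasurable_sub q μ))
    (measurable_kept μ).aemeasurable

theorem fst_splitting (q : I) (μ : PointMeasure X) :
    (splitting q μ).map Prod.fst = thinningLaw q μ :=
  Measure.map_map measurable_fst (measurable_kept_sub_kept μ)

theorem lintegral_bernoulliMeasure (q : I) (s t : ℝ≥0) :
    ∫⁻ b, (if b = true then (s : ℝ≥0∞) else t) ∂(bernoulliMeasure true false q) =
      (unitInterval.toNNReal q * s + unitInterval.toNNReal (σ q) * t : ℝ≥0) := by
  rw [bernoulliMeasure_def, lintegral_add_measure, lintegral_smul_measure, lintegral_smul_measure,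
    lintegral_dirac, lintegral_dirac]
  simp [ENNReal.smul_def]

/-- The joint generating function of the counts of retained and deleted points. -/
theorem lintegral_splitting (q : I) (μ : PointMeasure X) {ι : Type*} [Fintype ι] {A : ι → Set X}
    (hm : ∀ i, MeasurableSet (A i)) (hb : ∀ i, Bornology.IsBounded (A i))
    (hd : Pairwise (Function.onFun Disjoint A)) (s t : ι → ℝ≥0) :
    ∫⁻ p, (∏ i, (s i : ℝ≥0∞) ^ count (A i) p.1) * ∏ i, (t i : ℝ≥0∞) ^ count (A i) p.2
      ∂(splitting q μ) =
    ∏ i, ((unitInterval.toNNReal q * s i + unitInterval.toNNReal (σ q) * t i : ℝ≥0) : ℝ≥0∞) ^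
      count (A i) μ := by
  classical
  have hmeas : Measurable fun p : PointMeasure X × PointMeasure X =>
      (∏ i, (s i : ℝ≥0∞) ^ count (A i) p.1) * ∏ i, (t i : ℝ≥0∞) ^ count (A i) p.2 := by
    have h1 : ∀ i, Measurable fun p : PointMeasure X × PointMeasure X => count (A i) p.1 :=
      fun i => (measurable_count (hm i)).comp measurable_fst
    have h2 : ∀ i, Measurable fun p : PointMeasure X × PointMeasure X => count (A i) p.2 :=
      fun i => (measurable_count (hm i)).comp measurable_snd
    fun_prop
  rw [splitting, lintegral_map hmeas (measurable_kept_sub_kept μ)]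
  let T : ι → Finset (Points μ) := fun i => (finite_points (hm i) (hb i) μ).toFinset
  let J := Σ i, {p // p ∈ T i}
  -- Disjointness of the A i lets each point occur in one factor only, so distinct factors use
  -- distinct, independent coins.
  have hinj : Function.Injective fun j : J => j.2.1 := by
    rintro ⟨i, p, hp⟩ ⟨i', p', hp'⟩ (rfl : p = p')
    have : i = i' := by
      by_contra hne
      exact Set.disjoint_left.1 (hd hne) (by simpa [T] using hp) (by simpa [T] using hp')
    subst this
    rfl
  have hind := ((iIndepFun_infinitePi (P := fun _ : Points μ => bernoulliMeasure true false q)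
    (X := fun _ => id) fun _ => measurable_id).precomp hinj).comp
      (fun (j : J) (b : Bool) => if b = true then (s j.1 : ℝ≥0∞) else t j.1)
      fun j => measurable_of_countable _
  -- One factor per point of each A i: s i if it is kept, t i if it is deleted.
  have hpow : ∀ ω : Points μ → Bool, (∏ i, (s i : ℝ≥0∞) ^ count (A i) (kept μ ω)) *
      ∏ i, (t i : ℝ≥0∞) ^ count (A i) (μ - kept μ ω) =
      ∏ j : J, if ω j.2.1 = true then (s j.1 : ℝ≥0∞) else t j.1 := fun ω => by
    rw [Fintype.prod_sigma, ← Finset.prod_mul_distrib]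
    refine Finset.prod_congr rfl fun i _ => ?_
    rw [Finset.prod_coe_sort (T i) fun p => if ω p = true then (s i : ℝ≥0∞) else t i,
      count_kept (hm i) (hb i), count_sub_kept (hm i) (hb i), ← Finset.prod_pow_eq_pow_sum,
      ← Finset.prod_pow_eq_pow_sum, ← Finset.prod_mul_distrib]
    exact Finset.prod_congr rfl fun p _ => by split_ifs <;> simp
  simp_rw [hpow]
  refine (lintegral_prod_eq_prod_lintegral_of_indepFun Finset.univ _ hind fun j =>
    (measurable_of_countable _).comp (measurable_pi_apply _)).trans ?_
  rw [Fintype.prod_sigma]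
  refine Finset.prod_congr rfl fun i _ => ?_
  rw [count_eq_card_points (hm i) (hb i)]
  rw [Finset.prod_congr rfl (g := fun _ => ((unitInterval.toNNReal q * s i +
    unitInterval.toNNReal (σ q) * t i : ℝ≥0) : ℝ≥0∞))]
  · simp [T]
  · intro p _
    have e := lintegral_map (μ := Measure.infinitePi
      fun _ : Points μ => bernoulliMeasure true false q)
      (f := fun b : Bool => if b = true then (s i : ℝ≥0∞) else t i) (measurable_of_countable _)
      (measurable_pi_apply p.1)
    rw [Measure.infinitePi_map_eval, lintegral_bernoulliMeasure] at e
    exact e.symm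

end Thinning

/-! ### Generating functions of Poisson counts -/

section GenFun

variable {X : Type*} [MetricSpace X] [MeasurableSpace X]

/-- The generating function of the counts of a point process in the sets of a family. -/
noncomputable def genFun {ι : Type*} [Fintype ι] (P : Measure (PointMeasure X)) (A : ι → Set X)
    (s : ι → ℝ≥0) : ℝ≥0∞ :=
  ∫⁻ μ, ∏ i, (s i : ℝ≥0∞) ^ count (A i) μ ∂P

theorem measurable_prod_pow_count {ι : Type*} [Fintype ι] {A : ι → Set X}
    (hm : ∀ i, MeasurableSet (A i)) (s : ι → ℝ≥0) :
    Measurable fun μ : PointMeasure X => ∏ i, (s i : ℝ≥0∞) ^ count (A i) μ := by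
  have := fun i => measurable_count (hm i)
  fun_prop

variable {ι : Type*} [Fintype ι] {A : ι → Set X} {P : Measure (PointMeasure X)}

theorem genFun_of_isPoisson {ρ : Measure X}
    (hP : IsPoissonWithIntensity ρ P) (hm : ∀ i, MeasurableSet (A i))
    (hb : ∀ i, Bornology.IsBounded (A i)) (hd : Pairwise (Function.onFun Disjoint A))
    (s : ι → ℝ≥0) :
    genFun P A s = ∏ i, ENNReal.ofReal (Real.exp (-((ρ (A i)).toNNReal * (1 - s i)))) := by
  let e := Fintype.equivFin ι
  have hind : iIndepFun (fun (i : ι) (μ : PointMeasure X) => μ.1 (A i)) P := by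
    have := (hP.indep_count _ (A ∘ e.symm) (fun _ => hm _) (fun _ => hb _)
      fun i j h => hd (e.symm.injective.ne h)).precomp e.injective
    simpa using this
  have hg : ∀ i, Measurable fun x : ℝ≥0∞ => (s i : ℝ≥0∞) ^ ⌊x.toReal⌋₊ := fun i =>
    (measurable_of_countable fun n : ℕ => (s i : ℝ≥0∞) ^ n).comp measurable_floor_toReal
  refine (lintegral_prod_eq_prod_lintegral_of_indepFun Finset.univ _
    (hind.comp (fun i x => (s i : ℝ≥0∞) ^ ⌊x.toReal⌋₊) hg)
    fun i => (hg i).comp (measurable_eval (hm i))).trans ?_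
  refine Finset.prod_congr rfl fun i _ => ?_
  have h := lintegral_map (μ := P) (hg i) (measurable_eval (hm i))
  rw [hP.map_count _ (hm i) (hb i), lintegral_map (hg i) (measurable_of_countable _)] at h
  rw [← lintegral_pow_poissonMeasure]
  simpa using h.symm

end GenFun

/-! ### The splitting identity for Poisson processes -/

section Splitting

universe u
variable {X : Type u} [MetricSpace X] [TopologicalSpace.SeparableSpace X] [MeasurableSpace X]
  [BorelSpace X]

/-- The generating function in `lintegral_splitting` depends on μ only through its counts.
Measurability gives `Measure.bind` its intended meaning. -/
theorem measurable_splitting (q : I) : Measurable (splitting (X := X) q) := by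
  refine measurable_of_lintegral_prod_pow_count fun ι _ A hm hb hd s t _ _ μ ν h => ?_
  rw [lintegral_splitting q μ hm hb hd, lintegral_splitting q ν hm hb hd]
  simp_rw [h]

theorem measurable_thinningLaw (q : I) : Measurable (thinningLaw (X := X) q) := by
  have : thinningLaw (X := X) q = fun μ => (splitting q μ).map Prod.fst :=
    funext fun μ => (fst_splitting q μ).symm
  rw [this]
  exact (Measure.measurable_map _ measurable_fst).comp (measurable_splitting q)

theorem splittingLaw_eq_bind (q : I) (P : Measure (PointMeasure X)) :
    splittingLaw q P = P.bind (splitting q) := by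
  rw [splittingLaw]
  simp_rw [map_thinningLaw_eq_splitting]

theorem isProbabilityMeasure_bind {α β : Type*} [MeasurableSpace α] [MeasurableSpace β]
    (P : Measure α) [IsProbabilityMeasure P] {κ : α → Measure β} [∀ a, IsProbabilityMeasure (κ a)]
    (hκ : Measurable κ) : IsProbabilityMeasure (P.bind κ) :=
  ⟨by rw [Measure.bind_apply .univ hκ.aemeasurable]; simp⟩

instance (q : I) (P : Measure (PointMeasure X)) [IsProbabilityMeasure P] :
    IsProbabilityMeasure (thinning q P) :=
  isProbabilityMeasure_bind P (measurable_thinningLaw q)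

instance (q : I) (P : Measure (PointMeasure X)) [IsProbabilityMeasure P] :
    IsProbabilityMeasure (splittingLaw q P) := by
  rw [splittingLaw_eq_bind]
  exact isProbabilityMeasure_bind P (measurable_splitting q)

variable {ι : Type*} [Fintype ι] {A : ι → Set X} (P : Measure (PointMeasure X)) (q : I)

theorem lintegral_splittingLaw (hm : ∀ i, MeasurableSet (A i))
    (hb : ∀ i, Bornology.IsBounded (A i)) (hd : Pairwise (Function.onFun Disjoint A))
    (s t : ι → ℝ≥0) :
    ∫⁻ p, (∏ i, (s i : ℝ≥0∞) ^ count (A i) p.1) * ∏ i, (t i : ℝ≥0∞) ^ count (A i) p.2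
      ∂(splittingLaw q P) = genFun P A fun i => toNNReal q * s i + toNNReal (σ q) * t i := by
  rw [splittingLaw_eq_bind, Measure.lintegral_bind (measurable_splitting q).aemeasurable]
  · exact lintegral_congr fun μ => lintegral_splitting q μ hm hb hd s t
  · exact (((measurable_prod_pow_count hm s).comp measurable_fst).mul
      ((measurable_prod_pow_count hm t).comp measurable_snd)).aemeasurable

theorem genFun_thinning (hm : ∀ i, MeasurableSet (A i))
    (hb : ∀ i, Bornology.IsBounded (A i)) (hd : Pairwise (Function.onFun Disjoint A))
    (s : ι → ℝ≥0) :
    genFun (thinning q P) A s = genFun P A fun i => toNNReal q * s i + toNNReal (σ q) := by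
  rw [genFun, thinning, Measure.lintegral_bind (measurable_thinningLaw q).aemeasurable
    (measurable_prod_pow_count hm s).aemeasurable]
  refine lintegral_congr fun μ => ?_
  rw [← fst_splitting, lintegral_map (measurable_prod_pow_count hm s) measurable_fst]
  -- Taking t = 1 ignores the deleted points.
  simpa using lintegral_splitting q μ hm hb hd s fun _ => 1

theorem lintegral_prod_thinning [IsProbabilityMeasure P] (hm : ∀ i, MeasurableSet (A i))
    (hb : ∀ i, Bornology.IsBounded (A i)) (hd : Pairwise (Function.onFun Disjoint A))
    (s t : ι → ℝ≥0) :
    ∫⁻ p, (∏ i, (s i : ℝ≥0∞) ^ count (A i) p.1) * ∏ i, (t i : ℝ≥0∞) ^ count (A i) p.2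
      ∂((thinning q P).prod (thinning (σ q) P)) =
    (genFun P A fun i => toNNReal q * s i + toNNReal (σ q)) *
      genFun P A fun i => toNNReal (σ q) * t i + toNNReal q := by
  rw [lintegral_prod_mul (measurable_prod_pow_count hm s).aemeasurable
    (measurable_prod_pow_count hm t).aemeasurable]
  have h1 := genFun_thinning P q hm hb hd s
  have h2 := genFun_thinning P (σ q) hm hb hd t
  rw [unitInterval.symm_symm] at h2
  rw [← h1, ← h2]
  rfl

variable {P}

/-- The exponents add up because 1 - (qs + (1-q)t) = q(1-s) + (1-q)(1-t). -/
theorem splittingLaw_of_isPoisson [IsProbabilityMeasure P] (hP : IsPoisson P) :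
    splittingLaw q P = (thinning q P).prod (thinning (σ q) P) := by
  obtain ⟨ρ, -, hρ⟩ := hP
  refine ext_of_lintegral_prod_pow_count fun ι _ A hm hb hd s t _ _ => ?_
  rw [lintegral_splittingLaw P q hm hb hd, lintegral_prod_thinning P q hm hb hd,
    genFun_of_isPoisson hρ hm hb hd, genFun_of_isPoisson hρ hm hb hd,
    genFun_of_isPoisson hρ hm hb hd, ← Finset.prod_mul_distrib]
  refine Finset.prod_congr rfl fun i _ => ?_
  rw [← ENNReal.ofReal_mul (Real.exp_nonneg _), ← Real.exp_add]
  congr 2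
  push_cast
  simp only [coe_toNNReal, coe_symm_eq]
  ring

end Splitting

/-! ### The local exponential equation and the expansion at 1 -/

section FunctionalEquation

/-- A step of length 1/m fits into both ranges, so [0, 1] can be crossed in m such steps. -/
theorem eq_pow_of_local_mul {q : ℝ} (hq0 : 0 < q) {ψ : ℝ → ℝ} (h0 : ψ 0 = 1)
    (hψ : ∀ s t, 0 ≤ s → s ≤ q → 0 ≤ t → t ≤ 1 - q → ψ (s + t) = ψ s * ψ t)
    {m : ℕ} (hm : 0 < m) (hmq : 1 / (m : ℝ) ≤ q) (hmq' : 1 / (m : ℝ) ≤ 1 - q) :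
    ψ 1 = ψ (1 / m) ^ m := by
  have hm' : (0 : ℝ) < m := by exact_mod_cast hm
  set t : ℝ := 1 / m with ht
  have ht0 : 0 ≤ t := by positivity
  have step : ∀ s, 0 ≤ s → s + t ≤ 1 → ψ (s + t) = ψ s * ψ t := fun s hs hst => by
    rcases le_total s q with h | h
    · exact hψ s t hs h ht0 hmq'
    -- Beyond q, split off ψ q; the remainder s - q + t is then split with t in the first slot, as t
    -- ≤ q and s - q ≤ 1 - q.
    · have e1 : ψ (s + t) = ψ q * ψ (s - q + t) := by
        rw [← hψ q _ hq0.le le_rfl (by linarith) (by linarith)]; ring_nf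
      have e2 : ψ (s - q + t) = ψ t * ψ (s - q) := by
        rw [← hψ t _ ht0 hmq (by linarith) (by linarith)]; ring_nf
      have e3 : ψ s = ψ q * ψ (s - q) := by
        rw [← hψ q _ hq0.le le_rfl (by linarith) (by linarith)]; ring_nf
      rw [e1, e2, e3]; ring
  have hpow : ∀ k : ℕ, k ≤ m → ψ (k * t) = ψ t ^ k := fun k => by
    induction k with
    | zero => intro _; simp [h0]
    | succ k ih =>
      intro hk
      have hk' : ((k + 1 : ℕ) : ℝ) * t ≤ 1 := by
        rw [ht, mul_one_div, div_le_one hm']; exact_mod_cast hk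
      push_cast at hk' ⊢
      rw [add_mul, one_mul] at hk' ⊢
      rw [step _ (by positivity) hk', ih (by omega), pow_succ]
  rw [← hpow m le_rfl, ht, mul_one_div_cancel hm'.ne']

/-- With c_m = m(ψ(1/m) - 1), ψ(1) = (1 + c_m/m)^m for all large m, and the right side tends to e^c.
Neither continuity nor positivity of ψ enters. -/
theorem eq_exp_of_local_mul {q : ℝ} (hq0 : 0 < q) (hq1 : q < 1) {ψ : ℝ → ℝ} (h0 : ψ 0 = 1)
    (hψ : ∀ s t, 0 ≤ s → s ≤ q → 0 ≤ t → t ≤ 1 - q → ψ (s + t) = ψ s * ψ t) {c : ℝ}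
    (hc : Tendsto (fun n : ℕ => (n : ℝ) * (ψ (1 / n) - 1)) atTop (𝓝 c)) :
    ψ 1 = Real.exp c := by
  have h := Real.tendsto_one_add_pow_exp_of_tendsto hc
  refine tendsto_nhds_unique (tendsto_const_nhds.congr' ?_) h
  have hlim : Tendsto (fun n : ℕ => 1 / (n : ℝ)) atTop (𝓝 0) := tendsto_one_div_atTop_nhds_zero_nat
  filter_upwards [eventually_gt_atTop 0, hlim.eventually (eventually_le_nhds hq0),
    hlim.eventually (eventually_le_nhds (sub_pos.2 hq1))] with m h1 h2 h3
  rw [eq_pow_of_local_mul hq0 h0 hψ h1 h2 h3]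
  ring_nf

variable {ι : Type*}

theorem one_sub_sum_le_prod (s : Finset ι) {a : ι → ℝ} (h0 : ∀ i, 0 ≤ a i) (h1 : ∀ i, a i ≤ 1) :
    1 - ∑ i ∈ s, (1 - a i) ≤ ∏ i ∈ s, a i := by
  classical
  induction s using Finset.induction_on with
  | empty => simp
  | insert i s hi ih =>
    rw [Finset.sum_insert hi, Finset.prod_insert hi]
    have hp : ∏ i ∈ s, a i ≤ 1 := Finset.prod_le_one (fun i _ => h0 i) fun i _ => h1 i
    nlinarith [mul_nonneg (sub_nonneg.2 (h1 i)) (sub_nonneg.2 hp)]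

/-- Weierstrass' product inequality followed by Bernoulli's; it supplies the majorant for dominated
convergence. -/
theorem abs_prod_pow_sub_one_le [Fintype ι] {y : ι → ℝ} (h0 : ∀ i, 0 ≤ y i) (h1 : ∀ i, y i ≤ 1)
    (k : ι → ℕ) : |∏ i, (1 - y i) ^ k i - 1| ≤ ∑ i, k i * y i := by
  have ha0 : ∀ i, 0 ≤ (1 - y i) ^ k i := fun i => pow_nonneg (sub_nonneg.2 (h1 i)) _
  have ha1 : ∀ i, (1 - y i) ^ k i ≤ 1 := fun i =>
    pow_le_one₀ (sub_nonneg.2 (h1 i)) (by linarith [h0 i])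
  rw [abs_sub_comm, abs_of_nonneg
    (sub_nonneg.2 (Finset.prod_le_one (fun i _ => ha0 i) fun i _ => ha1 i))]
  have h2 := one_sub_sum_le_prod Finset.univ ha0 ha1
  have h3 : ∑ i, (1 - (1 - y i) ^ k i) ≤ ∑ i, k i * y i := Finset.sum_le_sum fun i _ => by
    have := one_add_mul_le_pow (a := -y i) (by linarith [h1 i]) (k i)
    rw [← sub_eq_add_neg] at this
    linarith
  linarith

/-- This is the derivative at 0 of x ↦ ∏ (1 - x y_i)^{k_i}, taken along x = 1/n. -/
theorem tendsto_mul_prod_pow_sub_one [Fintype ι] (y : ι → ℝ) (k : ι → ℕ) :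
    Tendsto (fun n : ℕ => (n : ℝ) * (∏ i, (1 - 1 / (n : ℝ) * y i) ^ k i - 1)) atTop
      (𝓝 (-∑ i, k i * y i)) := by
  classical
  have hd : HasDerivAt (fun x : ℝ => ∏ i, (1 - x * y i) ^ k i) (-∑ i, k i * y i) 0 := by
    have := HasDerivAt.fun_finsetProd (u := Finset.univ) (x := (0 : ℝ))
      (f := fun i x => (1 - x * y i) ^ k i) fun i _ =>
        (((hasDerivAt_id (0 : ℝ)).mul_const (y i)).const_sub 1).fun_pow (k i)
    refine this.congr_deriv ?_
    simp
  have hlim : Tendsto (fun n : ℕ => (n : ℝ)⁻¹) atTop (𝓝[≠] 0) :=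
    tendsto_nhdsWithin_iff.2 ⟨tendsto_inv_atTop_nhds_zero_nat, by
      filter_upwards [eventually_gt_atTop 0] with n hn
      simpa using hn.ne'⟩
  have := (hasDerivAt_iff_tendsto_slope_zero.1 hd).comp hlim
  simpa [Function.comp_def] using this

/-- The first order expansion at `1` of the generating function of integrable counts. -/
theorem tendsto_mul_integral_prod_pow_sub_one [Fintype ι] {Ω : Type*} [MeasurableSpace Ω]
    (P : Measure Ω) [IsProbabilityMeasure P] {N : ι → Ω → ℕ} (hN : ∀ i, Measurable (N i))
    (hint : ∀ i, Integrable (fun ω => (N i ω : ℝ)) P) {y : ι → ℝ} (h0 : ∀ i, 0 ≤ y i)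
    (h1 : ∀ i, y i ≤ 1) :
    Tendsto (fun n : ℕ => (n : ℝ) * (∫ ω, ∏ i, (1 - 1 / (n : ℝ) * y i) ^ N i ω ∂P - 1)) atTop
      (𝓝 (-∑ i, (∫ ω, (N i ω : ℝ) ∂P) * y i)) := by
  have hmeas : ∀ x : ℝ, Measurable fun ω => ∏ i, (1 - x * y i) ^ N i ω := fun x => by fun_prop
  have hx : ∀ n : ℕ, ∀ i, 0 ≤ 1 / (n : ℝ) * y i ∧ 1 / (n : ℝ) * y i ≤ 1 := fun n i => by
    have : 1 / (n : ℝ) ≤ 1 := by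
      rcases Nat.eq_zero_or_pos n with rfl | hn
      · simp
      · rw [div_le_one (by exact_mod_cast hn)]; exact_mod_cast hn
    exact ⟨mul_nonneg (by positivity) (h0 i), mul_le_one₀ this (h0 i) (h1 i)⟩
  have hbd : ∀ (n : ℕ) ω, |∏ i, (1 - 1 / (n : ℝ) * y i) ^ N i ω - 1| ≤
      1 / (n : ℝ) * ∑ i, N i ω * y i := fun n ω => by
    refine (abs_prod_pow_sub_one_le (fun i => (hx n i).1) (fun i => (hx n i).2) _).trans_eq ?_
    rw [Finset.mul_sum]
    exact Finset.sum_congr rfl fun i _ => by ring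
  have hsum : Integrable (fun ω => ∑ i, (N i ω : ℝ) * y i) P :=
    integrable_finsetSum _ fun i _ => (hint i).mul_const _
  have hint' : ∀ n : ℕ, Integrable (fun ω => ∏ i, (1 - 1 / (n : ℝ) * y i) ^ N i ω) P := fun n => by
    have : Integrable (fun ω => ∏ i, (1 - 1 / (n : ℝ) * y i) ^ N i ω - 1) P :=
      (hsum.const_mul (1 / (n : ℝ))).mono' ((hmeas _).sub_const 1).aestronglyMeasurable
        (.of_forall fun ω => hbd n ω)
    exact (this.add (integrable_const (1 : ℝ))).congr (.of_forall fun ω => sub_add_cancel _ _)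
  have key : Tendsto (fun n : ℕ => ∫ ω, (n : ℝ) * (∏ i, (1 - 1 / (n : ℝ) * y i) ^ N i ω - 1) ∂P)
      atTop (𝓝 (∫ ω, -∑ i, N i ω * y i ∂P)) := by
    -- The factor n cancels the 1/n in `hbd`, so the majorant does not depend on n; integrability of
    -- the counts enters here.
    refine tendsto_integral_of_dominated_convergence (fun ω => ∑ i, N i ω * y i)
      (fun n => (((hmeas _).sub_const 1).const_mul _).aestronglyMeasurable) hsum
      (fun n => .of_forall fun ω => ?_)
      (.of_forall fun ω => tendsto_mul_prod_pow_sub_one y fun i => N i ω)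
    rw [Real.norm_eq_abs, abs_mul, Nat.abs_cast]
    rcases Nat.eq_zero_or_pos n with rfl | hn
    · simpa using Finset.sum_nonneg fun i _ => mul_nonneg (Nat.cast_nonneg (N i ω)) (h0 i)
    · have hn' : (0 : ℝ) < n := by exact_mod_cast hn
      calc _ ≤ (n : ℝ) * (1 / (n : ℝ) * ∑ i, N i ω * y i) := by gcongr; exact hbd n ω
        _ = _ := by field_simp
  rw [integral_neg, integral_finsetSum _ fun i _ => (hint i).mul_const _] at key
  simp_rw [integral_mul_const] at key
  refine key.congr fun n => ?_
  rw [integral_const_mul, integral_sub (hint' n) (integrable_const 1)]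
  simp

end FunctionalEquation

/-! ### From the splitting identity to the Poisson property -/

section Converse

variable {X : Type*} [MetricSpace X] [MeasurableSpace X]
  {ι : Type*} [Fintype ι] {A : ι → Set X} {P : Measure (PointMeasure X)}

theorem toReal_genFun (hm : ∀ i, MeasurableSet (A i)) (s : ι → ℝ≥0) :
    (genFun P A s).toReal = ∫ μ, ∏ i, (s i : ℝ) ^ count (A i) μ ∂P := by
  have := fun i => measurable_count (hm i)
  rw [integral_eq_lintegral_of_nonneg_ae (.of_forall fun μ => by positivity)
    (by fun_prop : Measurable fun μ => ∏ i, (s i : ℝ) ^ count (A i) μ).aestronglyMeasurable]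
  congr 1
  refine lintegral_congr fun μ => ?_
  rw [ENNReal.ofReal_prod_of_nonneg (fun i _ => by positivity)]
  refine Finset.prod_congr rfl fun i _ => ?_
  rw [ENNReal.ofReal_pow (by positivity), ENNReal.ofReal_coe_nnreal]

theorem genFun_ne_top [IsProbabilityMeasure P] {s : ι → ℝ≥0} (hs : ∀ i, s i ≤ 1) :
    genFun P A s ≠ ∞ := by
  refine ((lintegral_mono fun μ => Finset.prod_le_one' fun i _ =>
    pow_le_one₀ bot_le (ENNReal.coe_le_one_iff.2 (hs i))).trans_lt
      (?_ : ∫⁻ _, 1 ∂P < ∞)).ne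
  simp

theorem firstMoment_apply {B : Set X} (hB : MeasurableSet B) :
    firstMoment P B = ∫⁻ μ, μ.1 B ∂P :=
  Measure.bind_apply hB measurable_subtype_coe.aemeasurable

theorem lintegral_count {B : Set X} (hB : MeasurableSet B) (hb : Bornology.IsBounded B) :
    ∫⁻ μ, ENNReal.ofReal (count B μ) ∂P = firstMoment P B := by
  rw [firstMoment_apply hB]
  exact lintegral_congr fun μ => by rw [ENNReal.ofReal_natCast, coe_count hB hb]

theorem integrable_count (hP : IsFirstOrder P) {B : Set X} (hB : MeasurableSet B)
    (hb : Bornology.IsBounded B) : Integrable (fun μ => (count B μ : ℝ)) P := by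
  refine ⟨((measurable_of_countable fun n : ℕ => (n : ℝ)).comp
    (measurable_count hB)).aestronglyMeasurable, ?_⟩
  rw [hasFiniteIntegral_iff_ofReal (.of_forall fun μ => Nat.cast_nonneg _), lintegral_count hB hb]
  exact hP B hB hb

theorem integral_count {B : Set X} (hB : MeasurableSet B) (hb : Bornology.IsBounded B) :
    ∫ μ, (count B μ : ℝ) ∂P = (firstMoment P B).toNNReal := by
  rw [integral_eq_lintegral_of_nonneg_ae (.of_forall fun μ => Nat.cast_nonneg _)
    ((measurable_of_countable fun n : ℕ => (n : ℝ)).comp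
      (measurable_count hB)).aestronglyMeasurable, lintegral_count hB hb]
  rfl

theorem genFun_add_of_splittingLaw_eq_prod [TopologicalSpace.SeparableSpace X] [BorelSpace X]
    [IsProbabilityMeasure P] {q : I}
    (h : splittingLaw q P = (thinning q P).prod (thinning (σ q) P))
    (hm : ∀ i, MeasurableSet (A i)) (hb : ∀ i, Bornology.IsBounded (A i))
    (hd : Pairwise (Function.onFun Disjoint A)) (s t : ι → ℝ≥0) :
    (genFun P A fun i => toNNReal q * s i + toNNReal (σ q) * t i) =
      (genFun P A fun i => toNNReal q * s i + toNNReal (σ q)) *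
      genFun P A fun i => toNNReal (σ q) * t i + toNNReal q := by
  rw [← lintegral_splittingLaw P q hm hb hd, h, lintegral_prod_thinning P q hm hb hd]

theorem genFun_eq_of_splittingLaw_eq_prod [TopologicalSpace.SeparableSpace X] [BorelSpace X]
    [IsProbabilityMeasure P] (hP : IsFirstOrder P) {q : I} (hq0 : 0 < q) (hq1 : q < 1)
    (h : splittingLaw q P = (thinning q P).prod (thinning (σ q) P))
    (hm : ∀ i, MeasurableSet (A i)) (hb : ∀ i, Bornology.IsBounded (A i))
    (hd : Pairwise (Function.onFun Disjoint A)) {s : ι → ℝ≥0} (hs : ∀ i, s i ≤ 1) :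
    genFun P A s =
      ∏ i, ENNReal.ofReal (Real.exp (-((firstMoment P (A i)).toNNReal * (1 - s i)))) := by
  have hq0' : (0 : ℝ) < q := hq0
  have hq1' : (0 : ℝ) < 1 - q := sub_pos.2 hq1
  have hs' : ∀ i, (s i : ℝ) ≤ 1 := fun i => by exact_mod_cast hs i
  let y : ι → ℝ := fun i => 1 - s i
  have hy0 : ∀ i, 0 ≤ y i := fun i => sub_nonneg.2 (hs' i)
  have hy1 : ∀ i, y i ≤ 1 := fun i => sub_le_self _ (s i).2
  -- G along the segment from the all-ones vector (x = 0) to s (x = 1).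
  let ψ : ℝ → ℝ := fun x => ∫ μ, ∏ i, (1 - x * y i) ^ count (A i) μ ∂P
  have hψ : ∀ a b : ℝ, 0 ≤ a → a ≤ q → 0 ≤ b → b ≤ 1 - (q : ℝ) → ψ (a + b) = ψ a * ψ b := by
    intro a b ha haq hb' hbq
    have h1 : ∀ i, 0 ≤ 1 - a / q * y i := fun i => sub_nonneg.2
      (mul_le_one₀ ((div_le_one hq0').2 haq) (hy0 i) (hy1 i))
    have h2 : ∀ i, 0 ≤ 1 - b / (1 - q) * y i := fun i => sub_nonneg.2
      (mul_le_one₀ ((div_le_one hq1').2 hbq) (hy0 i) (hy1 i))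
    -- Chosen so that the three arguments of G become 1 - (a+b)y, 1 - ay and 1 - by. The bounds a ≤
    -- q and b ≤ 1-q keep both vectors non-negative, so `toNNReal` changes nothing.
    have := congrArg ENNReal.toReal (genFun_add_of_splittingLaw_eq_prod h hm hb hd
      (fun i => (1 - a / q * y i).toNNReal) fun i => (1 - b / (1 - q) * y i).toNNReal)
    rw [ENNReal.toReal_mul, toReal_genFun hm, toReal_genFun hm, toReal_genFun hm] at this
    simp only [NNReal.coe_add, NNReal.coe_mul, coe_toNNReal, coe_symm_eq,
      Real.coe_toNNReal _ (h1 _), Real.coe_toNNReal _ (h2 _)] at this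
    have e1 : ∀ i, q * (1 - a / q * y i) + (1 - q) * (1 - b / (1 - q) * y i) =
        1 - (a + b) * y i := fun i => by field_simp; ring
    have e2 : ∀ i, q * (1 - a / q * y i) + (1 - q) = 1 - a * y i := fun i => by field_simp; ring
    have e3 : ∀ i, (1 - q) * (1 - b / (1 - q) * y i) + q = 1 - b * y i :=
      fun i => by field_simp; ring
    simp_rw [e1, e2, e3] at this
    exact this
  have hlim := tendsto_mul_integral_prod_pow_sub_one P (fun i => measurable_count (hm i))
    (fun i => integrable_count hP (hm i) (hb i)) hy0 hy1
  have hexp := eq_exp_of_local_mul hq0' hq1 (ψ := ψ) (by simp [ψ]) hψ hlim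
  rw [← ENNReal.ofReal_toReal (genFun_ne_top hs), toReal_genFun hm,
    ← ENNReal.ofReal_prod_of_nonneg fun i _ => Real.exp_nonneg _, ← Real.exp_sum]
  congr 1
  convert hexp using 1
  · simp [ψ, y]
  · congr 1
    rw [← Finset.sum_neg_distrib]
    exact Finset.sum_congr rfl fun i _ => by rw [integral_count (hm i) (hb i)]

/-- The counts are independent and Poisson distributed if their generating function is that of
independent Poisson variables. -/
theorem map_count_eq_pi [IsProbabilityMeasure P] (hm : ∀ i, MeasurableSet (A i)) {r : ι → ℝ≥0}
    (h : ∀ s : ι → ℝ≥0, (∀ i, s i ≤ 1) →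
      genFun P A s = ∏ i, ENNReal.ofReal (Real.exp (-(r i * (1 - s i))))) :
    P.map (fun μ i => count (A i) μ) = Measure.pi fun i => poissonMeasure (r i) := by
  have hc : Measurable fun μ i => count (A i) μ :=
    measurable_pi_lambda _ fun i => measurable_count (hm i)
  have := Measure.isProbabilityMeasure_map (μ := P) hc.aemeasurable
  refine ext_of_lintegral_prod_pow fun s hs => ?_
  rw [lintegral_map (by fun_prop) hc]
  refine (h s hs).trans ?_
  have hind := iIndepFun_pi (μ := fun i => poissonMeasure (r i))
    (X := fun i n => (s i : ℝ≥0∞) ^ n) fun i => (measurable_of_countable _).aemeasurable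
  rw [lintegral_prod_eq_prod_lintegral_of_indepFun Finset.univ _ hind fun i =>
    (measurable_of_countable _).comp (measurable_pi_apply i)]
  refine Finset.prod_congr rfl fun i _ => ?_
  rw [← lintegral_pow_poissonMeasure, ← (measurePreserving_eval (fun i => poissonMeasure (r i))
    i).map_eq, lintegral_map (measurable_of_countable _) (measurable_pi_apply i)]

theorem isPoissonWithIntensity_of_genFun [IsProbabilityMeasure P] {ρ : Measure X}
    (h : ∀ (n : ℕ) (A : Fin n → Set X), (∀ i, MeasurableSet (A i)) →
      (∀ i, Bornology.IsBounded (A i)) → Pairwise (Function.onFun Disjoint A) →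
      ∀ s : Fin n → ℝ≥0, (∀ i, s i ≤ 1) →
        genFun P A s = ∏ i, ENNReal.ofReal (Real.exp (-((ρ (A i)).toNNReal * (1 - s i))))) :
    IsPoissonWithIntensity ρ P := by
  have hmap : ∀ (n : ℕ) (A : Fin n → Set X), (∀ i, MeasurableSet (A i)) →
      (∀ i, Bornology.IsBounded (A i)) → Pairwise (Function.onFun Disjoint A) →
      ∀ i, P.map (count (A i)) = poissonMeasure (ρ (A i)).toNNReal := by
    intro n A hm hb hd i
    rw [← (measurePreserving_eval (fun i => poissonMeasure (ρ (A i)).toNNReal) i).map_eq,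
      ← map_count_eq_pi hm (h n A hm hb hd), Measure.map_map (measurable_pi_apply i)
        (measurable_pi_lambda _ fun i => measurable_count (hm i))]
    rfl
  have hcast : Measurable fun n : ℕ => (n : ℝ≥0∞) := measurable_of_countable _
  refine ⟨fun B hB hb => ?_, fun n A hm hb hd => ?_⟩
  -- A single set is a family over `Fin 1`, where disjointness is vacuous.
  · rw [← hmap 1 (fun _ => B) (fun _ => hB) (fun _ => hb)
      (fun i j hij => (hij (Subsingleton.elim i j)).elim) 0,
      Measure.map_map hcast (measurable_count hB)]
    exact congrArg P.map (funext fun μ => (coe_count hB hb μ).symm)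
  · have hind : iIndepFun (fun i => count (A i)) P := by
      rw [iIndepFun_iff_map_fun_eq_pi_map fun i => (measurable_count (hm i)).aemeasurable,
        map_count_eq_pi hm (h n A hm hb hd)]
      simp_rw [hmap n A hm hb hd]
    have := hind.comp (fun _ k => (k : ℝ≥0∞)) fun _ => hcast
    convert this using 2 with i
    exact funext fun μ => (coe_count (hm i) (hb i) μ).symm

end Converse
end PointProcess

theorem theorem1 {X : Type*} [MetricSpace X] [CompleteSpace X]
    [TopologicalSpace.SeparableSpace X] [MeasurableSpace X] [BorelSpace X]
    (P : Measure (PointProcess.PointMeasure X)) [IsProbabilityMeasure P]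
    (hP : PointProcess.IsFirstOrder P) :
    PointProcess.IsPoisson P ↔
      ∃ q : unitInterval, 0 < q ∧ q < 1 ∧
        PointProcess.splittingLaw q P =
          (PointProcess.thinning q P).prod (PointProcess.thinning (unitInterval.symm q) P) := by
  constructor
  · intro h
    -- Any q in (0, 1) would serve.
    exact ⟨⟨1 / 2, by norm_num, by norm_num⟩, Subtype.mk_lt_mk.2 (by norm_num),
      Subtype.mk_lt_mk.2 (by norm_num), PointProcess.splittingLaw_of_isPoisson _ h⟩
  · rintro ⟨q, hq0, hq1, h⟩
    exact ⟨PointProcess.firstMoment P, hP,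
      PointProcess.isPoissonWithIntensity_of_genFun fun n A hm hb hd s hs =>
        PointProcess.genFun_eq_of_splittingLaw_eq_prod hP hq0 hq1 h hm hb hd hs⟩
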